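/- Let $H$ be an infinite-dimensional separable real Hilbert space, $L(H)$ the Banach algebra of bounded linear operators on $H$, $GL(H)$ its group of invertible elements, and $O(H)=\{T\in GL(H): T^*T=TT^*=I\}$. Let $\mathrm{Gr}(H)$ be the set of all closed subspaces of $H$, with the metric $\mathrm{dist}(V,W)=\|P_V-P_W\|$, where $P_V$ is the orthogonal projection of $H$ onto $V$. Let $[a,b]\subset\mathbb R$ be a compact interval and $k\in\{0,1,2,\dots,\infty,\omega\}$ ($C^\omega$ means real analytic). Maps into $O(H)$ or $GL(H)$ are called $C^k$ if they are $C^k$ as maps into $L(H)$. A curve $[a,b]\ni t\mapsto V_t\in\mathrm{Gr}(H)$ is called of class $C^k$ if for every $t_0\in[a,b]$ there are $\varepsilon>0$, a $C^k$ map $\Psi:[a,b]\cap(t_0-\varepsilon,t_0+\varepsilon)\to GL(H)$ and a closed subspace $V_\star\subseteq H$ such that $\Psi_t(V_t)=V_\star$ for all $t\in[a,b]\cap(t_0-\varepsilon,t_0+\varepsilon)$. (i) Let $t\mapsto V_t$, $t\in[a,b]$, be a curve of class $C^k$ in $\mathrm{Gr}(H)$, let $W$ be an element of the connected component of $V_a$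 in $\mathrm{Gr}(H)$, and let $\varphi\in O(H)$ satisfy $\varphi(W)=V_a$. Then there is a $C^k$ curve $\Phi:[a,b]\to O(H)$ such that $\Phi_t(W)=V_t$ for all $t\in[a,b]$ and $\Phi_a=\varphi$. (ii) A symmetry of $H$ is a self-adjoint operator $J\in L(H)$ with $J^2=I$. Let $[a,b]\ni t\mapsto J_t\in L(H)$ be a $C^k$ map such that $J_t$ is a symmetry for every $t$. Then there are a $C^k$ map $U:[a,b]\to O(H)$ and a fixed symmetry $J$ of $H$ such that $U_tJ_tU_t^*=J$ for all $t\in[a,b]$. -/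

import Mathlib

open Set

/-- The Grassmannian of all closed subspaces of the real Hilbert space `H`. -/
def HilbertGr (H : Type*) [NormedAddCommGroup H] [InnerProductSpace ℝ H] : Type _ :=
  ClosedSubmodule ℝ H

namespace HilbertGr

variable {H : Type*} [NormedAddCommGroup H] [InnerProductSpace ℝ H]

/-- The underlying linear subspace of a point of the Grassmannian. -/
def space (V : HilbertGr H) : Submodule ℝ H := ClosedSubmodule.toSubmodule V

variable [CompleteSpace H]

instance instHasOrthogonalProjectionSpace (V : HilbertGr H) : V.space.HasOrthogonalProjection :=
  haveI : CompleteSpace V.space := (ClosedSubmodule.isClosed' V).completeSpace_coe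
  inferInstance

/-- The orthogonal projection onto `V`, as a bounded operator from `H` into `H`. -/
noncomputable def proj (V : HilbertGr H) : H →L[ℝ] H := V.space.starProjection

theorem proj_injective : Function.Injective (proj : HilbertGr H → (H →L[ℝ] H)) := by
  intro V W h
  have h1 : V.space = W.space := by
    rw [← Submodule.range_starProjection V.space, ← Submodule.range_starProjection W.space]
    exact congrArg (fun T : H →L[ℝ] H => T.range) h
  exact ClosedSubmodule.toSubmodule_injective h1

/-- The metric `dist V W = ‖P_V - P_W‖` on the Grassmannian. -/
noncomputable instance instMetricSpace : MetricSpace (HilbertGr H) :=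
  MetricSpace.induced proj proj_injective inferInstance

theorem dist_eq (V W : HilbertGr H) : dist V W = ‖V.proj - W.proj‖ :=
  dist_eq_norm V.proj W.proj

/-- The curve `t ↦ V t`, `t ∈ I`, of closed subspaces of `H` is of class `C^k`
(`k = 0, 1, …, ∞, ω`): around each `t₀ ∈ I` there is a `C^k` map `Ψ` with values in `GL(H)` and a
closed subspace `Vstar` with `Ψ t (V t) = Vstar`. Only the values of `V` on `I` matter. -/
def IsCkCurve (k : WithTop ℕ∞) (I : Set ℝ) (V : ℝ → HilbertGr H) : Prop :=
  ∀ t₀ ∈ I, ∃ ε > (0 : ℝ), ∃ (Ψ : ℝ → (H →L[ℝ] H)) (Vstar : HilbertGr H),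
    ContDiffOn ℝ k Ψ (I ∩ Ioo (t₀ - ε) (t₀ + ε)) ∧
    ∀ t ∈ I ∩ Ioo (t₀ - ε) (t₀ + ε),
      IsUnit (Ψ t) ∧ (V t).space.map (Ψ t : H →ₗ[ℝ] H) = Vstar.space

end HilbertGr

/-- The orthogonal group `O(H)`: bounded operators `T` with `T* T = T T* = 1`. -/
noncomputable def orthogonalGroup (H : Type*) [NormedAddCommGroup H] [InnerProductSpace ℝ H]
    [CompleteSpace H] : Submonoid (H →L[ℝ] H) :=
  unitary (H →L[ℝ] H)

/-- A symmetry of `H`: a bounded self-adjoint operator `J` with `J² = 1`. -/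
def IsSymmetryOp {H : Type*} [NormedAddCommGroup H] [InnerProductSpace ℝ H]
    [CompleteSpace H] (J : H →L[ℝ] H) : Prop :=
  IsSelfAdjoint J ∧ J * J = 1

/-! A closed subspace V is encoded by the symmetry 2P_V - 1, so both assertions reduce to finding a
C^k path of unitaries with J_t F_t = F_t J_a and F_a = 1 (`exists_contDiffOn_unitary_intertwining`).

For nearby symmetries J₁, J₂ the operator (1 + J₂J₁)/2 is close to 1 and intertwines them. Its polar
unitary part M(M*M)^(-1/2) still intertwines and is analytic in M. By uniform continuity finitely
many such steps cover [a, b] and give a continuous solution G.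

Regularity comes from correcting an approximation: take a polynomial path Θ uniformly close to G,
average it to (Θ + J_t Θ J_a)/2, which intertwines exactly, and pass to the unitary part. Only J
limits the smoothness, so every k from 0 to ω is treated alike.

For subspaces, Kato's formula expresses P_V analytically through the oblique idempotent Ψ⁻¹ P_* Ψ,
where P_* projects onto the model subspace; hence t ↦ P_{V_t} is C^k. -/

open Filter Topology ContinuousLinearMap

/-! ### Square root near 1 and the polar unitary part -/

section UnitaryTransport

variable {A : Type*} [NormedRing A] [NormedAlgebra ℝ A] [StarRing A] [CStarRing A]
  [StarModule ℝ A] [CompleteSpace A]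

omit [StarModule ℝ A] in
/-- An analytic square root near `1`. By local uniqueness it inherits self-adjointness and
commutation with unitaries. -/
theorem exists_contDiffAt_sqrt_near_one :
    ∃ (S : A → A), S 1 = 1 ∧ ∀ᶠ X in 𝓝 (1 : A), ContDiffAt ℝ ⊤ S X ∧ S X * S X = X ∧
      (star X = X → star (S X) = S X) ∧
      ∀ R ∈ unitary A, R * X = X * R → R * S X = S X * R := by
  have hf : ContDiffAt ℝ ⊤ (fun x : A => x * x) 1 := by fun_prop
  -- Squaring has derivative 2 at 1, so the inverse function theorem applies.
  let f' : A ≃L[ℝ] A := ContinuousLinearEquiv.smulLeft (Units.mk0 (2 : ℝ) two_ne_zero)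
  have hf' : HasFDerivAt (fun x : A => x * x) (f' : A →L[ℝ] A) 1 := by
    have h := (hasFDerivAt_id (𝕜 := ℝ) (1 : A)).mul' (hasFDerivAt_id (𝕜 := ℝ) (1 : A))
    convert! h using 1
    ext x
    simp [f', two_smul, Units.smul_def]
  have hn : (⊤ : WithTop ℕ∞) ≠ 0 := by simp
  set e := hf.toOpenPartialHomeomorph _ hf' hn with he
  have hcoe : ∀ x, e x = x * x := fun x => rfl
  have h1s : (1 : A) ∈ e.source := hf.mem_toOpenPartialHomeomorph_source hf' hn
  have h1t : (1 : A) ∈ e.target := by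
    have := hf.image_mem_toOpenPartialHomeomorph_target hf' hn
    simpa using this
  obtain ⟨r, hr, hball⟩ := Metric.isOpen_iff.1 e.open_source 1 h1s
  have hS1 : e.symm 1 = 1 := by
    have := e.left_inv h1s
    rwa [hcoe, mul_one] at this
  have hS : ContDiffAt ℝ ⊤ e.symm 1 := by
    have := hf.to_localInverse hf' hn
    rw [mul_one] at this
    exact this
  refine ⟨e.symm, hS1, ?_⟩
  -- A root in this ball is unique. The ball is centred at 1, hence stable under `star` and unitary
  -- conjugation, so the symmetries of X pass to its root.
  have huniq : ∀ X Y, Y ∈ Metric.ball (1 : A) r → Y * Y = X → e.symm X = Y := by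
    rintro X Y hY rfl
    exact e.left_inv (hball hY)
  have hmem : ∀ᶠ X in 𝓝 (1 : A), e.symm X ∈ Metric.ball (1 : A) r := by
    refine hS.continuousAt.eventually ?_
    rw [hS1]
    exact Metric.ball_mem_nhds _ hr
  filter_upwards [hS.eventually (by simp), hmem, e.open_target.mem_nhds h1t] with X hX hXr hXt
  have hsq : e.symm X * e.symm X = X := e.right_inv hXt
  refine ⟨hX, hsq, fun hstar => ?_, fun R hR hRX => ?_⟩
  · refine (huniq X _ ?_ ?_).symm
    · rw [mem_ball_iff_norm] at hXr ⊢
      rwa [← norm_star, star_sub, star_star, star_one]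
    · rw [← star_mul, hsq, hstar]
  · have hR1 : R * star R = 1 := (Unitary.mem_iff.1 hR).2
    have hR2 : star R * R = 1 := (Unitary.mem_iff.1 hR).1
    have key : e.symm X = R * e.symm X * star R := by
      refine huniq X _ ?_ ?_
      · rw [mem_ball_iff_norm] at hXr ⊢
        have : R * e.symm X * star R - 1 = R * (e.symm X - 1) * star R := by
          rw [mul_sub, sub_mul, mul_one, hR1]
        rwa [this, CStarRing.norm_mul_mem_unitary _ (Unitary.star_mem hR),
          CStarRing.norm_mem_unitary_mul _ hR]
      · calc R * e.symm X * star R * (R * e.symm X * star R)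
            = R * e.symm X * (star R * R) * e.symm X * star R := by simp only [mul_assoc]
          _ = R * (e.symm X * e.symm X) * star R := by rw [hR2, mul_one, mul_assoc R]
          _ = X := by rw [hsq, hRX, mul_assoc, hR1, mul_one]
    calc R * e.symm X = R * e.symm X * (star R * R) := by rw [hR2, mul_one]
      _ = e.symm X * R := by rw [← mul_assoc, ← key]

/-- The unitary part of the polar decomposition, as an analytic map on a uniform neighbourhood of
the unitary group. It preserves intertwining relations between symmetries. -/
theorem exists_contDiffAt_unitary_part :
    ∃ (U : A → A), ∃ η > (0 : ℝ), ∀ G ∈ unitary A, ∀ M : A, ‖M - G‖ < η →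
      ContDiffAt ℝ ⊤ U M ∧ U M ∈ unitary A ∧
      ∀ J₁ ∈ unitary A, ∀ J₂ : A, star J₁ = J₁ → star J₂ = J₂ → J₂ * M = M * J₁ →
        J₂ * U M = U M * J₁ := by
  obtain ⟨S, hS1, hS⟩ := exists_contDiffAt_sqrt_near_one (A := A)
  have hstar : ContDiff ℝ ⊤ (star : A → A) := (starL' ℝ : A ≃L[ℝ] A).contDiff
  have hScont : ContinuousAt S 1 := hS.self_of_nhds.1.continuousAt
  have hunit : ∀ᶠ X in 𝓝 (1 : A), IsUnit (S X) := by
    refine hScont.eventually ?_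
    rw [hS1]
    exact Units.isOpen.mem_nhds isUnit_one
  have hsq : Tendsto (fun N : A => star N * N) (𝓝 1) (𝓝 1) := by
    have : Continuous (fun N : A => star N * N) := by
      exact hstar.continuous.mul continuous_id
    simpa using this.tendsto 1
  have hev := (hsq.eventually (hS.and hunit)).and
    (Units.isOpen.mem_nhds (isUnit_one (M := A)))
  obtain ⟨η, hη, hball⟩ := Metric.eventually_nhds_iff_ball.1 hev
  refine ⟨fun M => M * Ring.inverse (S (star M * M)), η, hη, fun G hG M hM => ?_⟩
  have hG1 : G * star G = 1 := (Unitary.mem_iff.1 hG).2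
  have hG2 : star G * G = 1 := (Unitary.mem_iff.1 hG).1
  -- Translating by G* moves M near 1 without changing M*M; hence one η serves all unitaries G.
  have hN := hball (star G * M) (by
    rwa [mem_ball_iff_norm, ← hG2, ← mul_sub, CStarRing.norm_mem_unitary_mul _ (Unitary.star_mem hG)])
  have hNN : star (star G * M) * (star G * M) = star M * M := by
    rw [star_mul, star_star, mul_assoc, ← mul_assoc G, hG1, one_mul]
  rw [hNN] at hN
  obtain ⟨⟨⟨hSd, hSS, hSa, hSc⟩, hSu⟩, hMu⟩ := hN
  have hMu : IsUnit M := by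
    have hGu : IsUnit G := ⟨⟨G, star G, hG1, hG2⟩, rfl⟩
    have := hGu.mul hMu
    rwa [← mul_assoc, hG1, one_mul] at this
  set s := S (star M * M) with hs
  have hss : star s = s := hSa (by rw [star_mul, star_star])
  have hn1 : Ring.inverse s * s = 1 := Ring.inverse_mul_cancel _ hSu
  have hn2 : s * Ring.inverse s = 1 := Ring.mul_inverse_cancel _ hSu
  have hns : star (Ring.inverse s) = Ring.inverse s := by
    have : star (Ring.inverse s) * s = 1 := by
      rw [← hss, ← star_mul, hss, hn2, star_one]
    calc star (Ring.inverse s) = star (Ring.inverse s) * (s * Ring.inverse s) := by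
          rw [hn2, mul_one]
      _ = Ring.inverse s := by rw [← mul_assoc, this, one_mul]
  have hUU : star (M * Ring.inverse s) * (M * Ring.inverse s) = 1 := by
    calc star (M * Ring.inverse s) * (M * Ring.inverse s)
        = Ring.inverse s * (star M * M) * Ring.inverse s := by
          rw [star_mul, hns]; simp only [mul_assoc]
      _ = (Ring.inverse s * s) * (s * Ring.inverse s) := by
          rw [← hSS]; simp only [mul_assoc]
      _ = 1 := by rw [hn1, hn2, one_mul]
  refine ⟨?_, ?_, ?_⟩
  · have h1 : ContDiffAt ℝ ⊤ (fun M : A => star M * M) M := (hstar.mul contDiff_id).contDiffAt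
    have h2 : ContDiffAt ℝ ⊤ (fun M : A => S (star M * M)) M := ContDiffAt.comp M hSd h1
    obtain ⟨u, hu⟩ := hSu
    have h3 : ContDiffAt ℝ ⊤ (Ring.inverse : A → A) s := by
      rw [← hu]; exact contDiffAt_ringInverse ℝ u
    exact contDiffAt_id.mul (ContDiffAt.comp (g := Ring.inverse) M h3 h2)
  · rw [Unitary.mem_iff]
    refine ⟨hUU, ?_⟩
    -- An isometry that is invertible is unitary.
    have hu : IsUnit (M * Ring.inverse s) := hMu.mul (hSu.ringInverse)
    refine hu.mul_right_cancel ?_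
    rw [mul_assoc, hUU, mul_one, one_mul]
  · intro J₁ hJ₁ J₂ h1 h2 hint
    have hint' : star M * J₂ = J₁ * star M := by
      have := congrArg star hint
      rwa [star_mul, star_mul, h1, h2] at this
    have hc : J₁ * s = s * J₁ := hSc J₁ hJ₁ (by
      rw [← mul_assoc, ← hint', mul_assoc, hint, mul_assoc])
    have hc' : J₁ * Ring.inverse s = Ring.inverse s * J₁ := by
      calc J₁ * Ring.inverse s = Ring.inverse s * (s * J₁) * Ring.inverse s := by
            rw [← mul_assoc, hn1, one_mul]
        _ = Ring.inverse s * J₁ := by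
            rw [← hc]; simp only [mul_assoc]; rw [hn2, mul_one]
    change J₂ * (M * Ring.inverse s) = M * Ring.inverse s * J₁
    rw [← mul_assoc, hint, mul_assoc, hc', mul_assoc]

end UnitaryTransport

/-! ### Polynomial approximation of paths -/

section Approximation

variable {E : Type*} [NormedAddCommGroup E] [NormedSpace ℝ E]

/-- Weierstrass: continuous vector-valued functions on `[a, b]` are uniform limits of
analytic ones. -/
theorem exists_contDiff_norm_sub_lt {a b : ℝ} (hab : a < b) {G : ℝ → E} (hG : Continuous G)
    {ε : ℝ} (hε : 0 < ε) :
    ∃ Θ : ℝ → E, ContDiff ℝ ⊤ Θ ∧ ∀ t ∈ Icc a b, ‖Θ t - G t‖ < ε := by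
  let f : C(unitInterval, E) := ⟨fun s => G (a + (b - a) * s), by fun_prop⟩
  obtain ⟨n, hn⟩ := ((Metric.tendsto_nhds.1 (bernsteinApproximation_uniform f)) ε hε).exists
  -- The Bernstein polynomial of the rescaled function, written out so that it makes sense for every
  -- real t.
  refine ⟨fun t => ∑ i : Fin (n + 1), ((n.choose i : ℝ) * ((t - a) / (b - a)) ^ (i : ℕ) *
    (1 - (t - a) / (b - a)) ^ (n - i)) • f (bernstein.z i), by fun_prop, fun t ht => ?_⟩
  have hba : 0 < b - a := sub_pos.2 hab
  let s : unitInterval := ⟨(t - a) / (b - a), div_nonneg (sub_nonneg.2 ht.1) hba.le,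
    (div_le_one hba).2 (by linarith [ht.2])⟩
  have hs : f s = G t := by
    change G (a + (b - a) * ((t - a) / (b - a))) = G t
    rw [mul_div_cancel₀ _ hba.ne', add_sub_cancel]
  have := (ContinuousMap.dist_lt_iff hε).1 hn s
  rw [dist_eq_norm, hs, bernsteinApproximation.apply] at this
  simpa only [bernstein_apply] using this

end Approximation

/-! ### Intertwining paths of symmetries -/

section UnitaryTransport

theorem mem_unitary_of_symmetry {A : Type*} [Monoid A] [StarMul A] {J : A}
    (h : star J = J) (hJ : J * J = 1) : J ∈ unitary A := by
  rw [Unitary.mem_iff, h]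
  exact ⟨hJ, hJ⟩

variable {A : Type*} [NormedRing A] [NormedAlgebra ℝ A] [StarRing A] [CStarRing A]
  [StarModule ℝ A] [CompleteSpace A]

/-- A uniformly continuous path of symmetries is unitarily trivial, continuously, on each ray
`(-∞, a + n δ]`. -/
theorem exists_continuous_unitary_intertwining {J : ℝ → A} (hJ : UniformContinuous J)
    (hs : ∀ t, star (J t) = J t ∧ J t * J t = 1) (a c : ℝ) (ha : ∀ t ≤ a, J t = J a) :
    ∃ G : ℝ → A, Continuous G ∧ ∀ t, G t ∈ unitary A ∧ J (min t c) * G t = G t * J a := by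
  obtain ⟨U, η, hη, hU⟩ := exists_contDiffAt_unitary_part (A := A)
  obtain ⟨δ, hδ, hJδ⟩ := Metric.uniformContinuous_iff.1 hJ η hη
  -- Time is frozen at a + nδ/2, so each induction step moves it by at most δ/2, strictly less than
  -- δ.
  suffices h : ∀ n : ℕ, ∃ G : ℝ → A, Continuous G ∧
      ∀ t, G t ∈ unitary A ∧ J (min (min t c) (a + n * (δ / 2))) * G t = G t * J a by
    obtain ⟨n, hn⟩ := exists_nat_ge ((c - a) / (δ / 2))
    obtain ⟨G, hG, h⟩ := h n
    refine ⟨G, hG, fun t => ⟨(h t).1, ?_⟩⟩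
    rw [← (h t).2, min_eq_left (a := min t c)]
    rw [div_le_iff₀ (by positivity)] at hn
    linarith [min_le_right t c]
  intro n
  induction n with
  | zero =>
    refine ⟨fun _ => 1, continuous_const, fun t => ⟨one_mem _, ?_⟩⟩
    rw [mul_one, one_mul]
    refine ha _ ?_
    simp
  | succ n ih =>
    obtain ⟨G, hG, h⟩ := ih
    set x : ℝ → ℝ := fun t => min (min t c) (a + n * (δ / 2)) with hx
    set y : ℝ → ℝ := fun t => min (min t c) (a + (n + 1 : ℕ) * (δ / 2)) with hy
    -- K intertwines J (x t) with J (y t) and equals 1 while x t = y t.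
    set K : ℝ → A := fun t => (2⁻¹ : ℝ) • (1 + J (y t) * J (x t)) with hK
    have hxc : Continuous x := by fun_prop
    have hyc : Continuous y := by fun_prop
    have hKc : Continuous K :=
      (continuous_const.add ((hJ.continuous.comp hyc).mul (hJ.continuous.comp hxc))).const_smul _
    have hK1 : ∀ t, ‖K t - 1‖ < η := by
      intro t
      have hd : dist (y t) (x t) < δ := by
        have h1 : x t ≤ y t := by
          simp only [hx, hy, Nat.cast_succ]
          gcongr
          linarith
        have h2 : y t ≤ x t + δ / 2 := by
          simp only [hx, hy, Nat.cast_succ]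
          rw [← min_add_add_right]
          rw [add_mul, one_mul, ← add_assoc]
          exact min_le_min_right _ (by linarith)
        rw [Real.dist_eq, abs_of_nonneg] <;> linarith
      have h1 : K t - 1 = (2⁻¹ : ℝ) • ((J (y t) - J (x t)) * J (x t)) := by
        have : (1 : A) = (2⁻¹ : ℝ) • (1 + 1 : A) := by
          rw [← two_smul ℝ (1 : A), smul_smul]; norm_num
        conv_lhs => rw [this]
        simp only [hK]
        rw [sub_mul, (hs (x t)).2, ← smul_sub, add_sub_add_left_eq_sub]
      rw [h1, norm_smul,
        CStarRing.norm_mul_mem_unitary _ (mem_unitary_of_symmetry (hs (x t)).1 (hs (x t)).2)]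
      have := hJδ hd
      rw [dist_eq_norm] at this
      rw [Real.norm_of_nonneg (by norm_num)]
      linarith
    refine ⟨fun t => U (K t) * G t, ?_, fun t => ⟨?_, ?_⟩⟩
    · refine Continuous.mul (continuous_iff_continuousAt.2 fun t => ?_) hG
      exact ContinuousAt.comp (g := U) (hU 1 (one_mem _) _ (hK1 t)).1.continuousAt hKc.continuousAt
    · exact mul_mem (hU 1 (one_mem _) _ (hK1 t)).2.1 (h t).1
    · have hint : J (y t) * K t = K t * J (x t) := by
        simp only [hK, mul_smul_comm, smul_mul_assoc, mul_add, add_mul, mul_one, one_mul]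
        rw [← mul_assoc, (hs (y t)).2, mul_assoc, (hs (x t)).2, one_mul, mul_one, add_comm]
      have := (hU 1 (one_mem _) _ (hK1 t)).2.2 _
        (mem_unitary_of_symmetry (hs (x t)).1 (hs (x t)).2) _ (hs (x t)).1 (hs (y t)).1 hint
      change J (y t) * (U (K t) * G t) = U (K t) * G t * J a
      rw [← mul_assoc, this, mul_assoc, (h t).2, mul_assoc]

/-- A `C^k` path of symmetries on `[a, b]` is conjugate to a constant by a `C^k` path of
unitaries. The continuous solution is replaced by an analytic approximation, which is then
corrected to intertwine and to be unitary. -/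
theorem exists_contDiffOn_unitary_intertwining {k : WithTop ℕ∞} {a b : ℝ} (hab : a ≤ b)
    {J : ℝ → A} (hJ : ContDiffOn ℝ k J (Icc a b))
    (hs : ∀ t ∈ Icc a b, star (J t) = J t ∧ J t * J t = 1) :
    ∃ F : ℝ → A, ContDiffOn ℝ k F (Icc a b) ∧
      (∀ t ∈ Icc a b, F t ∈ unitary A ∧ J t * F t = F t * J a) ∧ F a = 1 := by
  rcases hab.eq_or_lt with rfl | hab'
  · refine ⟨fun _ => 1, contDiffOn_const, fun t ht => ⟨one_mem _, ?_⟩, rfl⟩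
    rw [mul_one, one_mul, le_antisymm ht.2 ht.1]
  have haI : a ∈ Icc a b := left_mem_Icc.2 hab
  -- Extending J by its endpoint values makes it uniformly continuous on ℝ and constant to the left
  -- of a.
  have hJc : UniformContinuous (IccExtend hab ((Icc a b).domRestrict J)) := by
    have h1 : UniformContinuous ((Icc a b).domRestrict J) :=
      CompactSpace.uniformContinuous_of_continuous hJ.continuousOn.domRestrict
    exact h1.comp (LipschitzWith.projIcc hab).uniformContinuous
  obtain ⟨G, hG, hGJ⟩ := exists_continuous_unitary_intertwining hJc
    (fun t => hs _ (projIcc a b hab t).2) a b (fun t ht => by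
      rw [IccExtend_of_le_left _ _ ht, IccExtend_of_le_left _ _ le_rfl])
  have hG' : ∀ t ∈ Icc a b, G t ∈ unitary A ∧ J t * G t = G t * J a := by
    intro t ht
    have := hGJ t
    rwa [min_eq_left ht.2, IccExtend_of_mem _ _ ht, IccExtend_of_mem _ _ haI] at this
  obtain ⟨U, η, hη, hU⟩ := exists_contDiffAt_unitary_part (A := A)
  obtain ⟨Θ, hΘ, hΘG⟩ := exists_contDiff_norm_sub_lt hab' hG hη
  -- The average over the involution T ↦ J_t T J_a: it fixes G t and is a contraction, so M stays as
  -- close to G as Θ is.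
  set M : ℝ → A := fun t => (2⁻¹ : ℝ) • (Θ t + J t * Θ t * J a) with hM
  have hJu : ∀ t ∈ Icc a b, J t ∈ unitary A := fun t ht =>
    mem_unitary_of_symmetry (hs t ht).1 (hs t ht).2
  have hMG : ∀ t ∈ Icc a b, ‖M t - G t‖ < η := by
    intro t ht
    have h1 : G t = (2⁻¹ : ℝ) • (G t + J t * G t * J a) := by
      rw [(hG' t ht).2, mul_assoc, (hs a haI).2, mul_one, ← two_smul ℝ (G t), smul_smul]
      norm_num
    have h2 : M t - G t = (2⁻¹ : ℝ) • ((Θ t - G t) + J t * (Θ t - G t) * J a) := by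
      conv_lhs => rw [h1]
      simp only [hM]
      rw [← smul_sub, mul_sub, sub_mul]
      congr 1
      abel
    have h3 : ‖J t * (Θ t - G t) * J a‖ = ‖Θ t - G t‖ := by
      rw [CStarRing.norm_mul_mem_unitary _ (hJu a haI), CStarRing.norm_mem_unitary_mul _ (hJu t ht)]
    rw [h2, norm_smul, Real.norm_of_nonneg (by norm_num)]
    have := norm_add_le (Θ t - G t) (J t * (Θ t - G t) * J a)
    linarith [hΘG t ht]
  have hMJ : ∀ t ∈ Icc a b, J t * M t = M t * J a := by
    intro t ht
    simp only [hM, mul_smul_comm, smul_mul_assoc, mul_add, add_mul]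
    rw [mul_assoc (J t * Θ t), (hs a haI).2, mul_one, mul_assoc (J t) (Θ t),
      ← mul_assoc (J t) (J t), (hs t ht).2, one_mul, add_comm]
  have hMd : ContDiffOn ℝ k M (Icc a b) :=
    (((hΘ.of_le le_top).contDiffOn).add ((hJ.mul (hΘ.of_le le_top).contDiffOn).mul
      contDiffOn_const)).const_smul _
  have hUM : ∀ t ∈ Icc a b, _ := fun t ht => hU (G t) (hG' t ht).1 (M t) (hMG t ht)
  have hUJ : ∀ t ∈ Icc a b, J t * U (M t) = U (M t) * J a := fun t ht =>
    (hUM t ht).2.2 _ (hJu a haI) _ (hs a haI).1 (hs t ht).1 (hMJ t ht)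
  have hUd : ContDiffOn ℝ k (fun t => U (M t)) (Icc a b) := fun t ht =>
    ((hUM t ht).1.of_le le_top).comp_contDiffWithinAt t (hMd t ht)
  -- The factor on the right commutes with J a and normalises the value at a to 1.
  refine ⟨fun t => U (M t) * star (U (M a)), hUd.mul contDiffOn_const, fun t ht => ⟨?_, ?_⟩, ?_⟩
  · exact mul_mem (hUM t ht).2.1 (Unitary.star_mem (hUM a haI).2.1)
  · have h := congrArg star (hUJ a haI)
    rw [star_mul, star_mul, (hs a haI).1] at h
    rw [← mul_assoc, hUJ t ht, mul_assoc, ← h, mul_assoc]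
  · exact (Unitary.mem_iff.1 (hUM a haI).2.1).2

end UnitaryTransport

/-! ### Smoothness of the operations in Kato's formula -/

section Calculus

variable {A : Type*} [NormedRing A] [NormedAlgebra ℝ A] [CompleteSpace A]

theorem ContDiffWithinAt.ringInverse {k : WithTop ℕ∞} {T : ℝ → A} {s : Set ℝ} {t : ℝ}
    (hT : ContDiffWithinAt ℝ k T s t) (hu : IsUnit (T t)) :
    ContDiffWithinAt ℝ k (fun t => Ring.inverse (T t)) s t := by
  obtain ⟨u, hu⟩ := hu
  have h : ContDiffAt ℝ k (Ring.inverse : A → A) (T t) := hu ▸ contDiffAt_ringInverse ℝ u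
  exact h.comp_contDiffWithinAt t hT

theorem ContDiffWithinAt.conj_of_isUnit {k : WithTop ℕ∞} {T : ℝ → A} {s : Set ℝ} {t : ℝ}
    (hT : ContDiffWithinAt ℝ k T s t) (Q : A) (hu : IsUnit (T t)) :
    ContDiffWithinAt ℝ k (fun t => Ring.inverse (T t) * Q * T t) s t :=
  ((hT.ringInverse hu).mul contDiffWithinAt_const).mul hT

theorem ContDiffWithinAt.mul_inverse_add_star [StarRing A] [CStarRing A] [StarModule ℝ A]
    {k : WithTop ℕ∞} {E : ℝ → A} {s : Set ℝ} {t : ℝ} (hE : ContDiffWithinAt ℝ k E s t)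
    (hu : IsUnit (E t + star (E t) - 1)) :
    ContDiffWithinAt ℝ k (fun t => E t * Ring.inverse (E t + star (E t) - 1)) s t := by
  have hstar : ContDiff ℝ k (star : A → A) := (starL' ℝ : A ≃L[ℝ] A).contDiff
  have h : ContDiffWithinAt ℝ k (fun t => E t + star (E t) - 1) s t :=
    (hE.add (hstar.contDiffAt.comp_contDiffWithinAt t hE)).sub contDiffWithinAt_const
  exact hE.mul (h.ringInverse hu)

end Calculus

/-! ### Projections along curves of subspaces -/

section Curves

variable {H : Type*} [NormedAddCommGroup H] [InnerProductSpace ℝ H] [CompleteSpace H]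

/-- Kato's formula: the orthogonal projection `P` onto the range of an idempotent `E` satisfies
`P (E + E* - 1) = E`, and `E + E* - 1` is invertible. -/
theorem eq_mul_inverse_of_idempotent {P E : H →L[ℝ] H} (hP : star P = P) (hE : E * E = E)
    (hPE : P * E = E) (hEP : E * P = P) :
    IsUnit (E + star E - 1) ∧ P = E * Ring.inverse (E + star E - 1) := by
  have hE' : star E * star E = star E := by rw [← star_mul, hE]
  -- The square is 1 plus a positive operator, hence bounded below by 1 and invertible.
  have hB : (E + star E - 1) * (E + star E - 1) = 1 + (E - star E) * star (E - star E) := by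
    simp only [star_sub, star_star, mul_sub, sub_mul, add_mul, mul_add, hE, hE', mul_one, one_mul]
    abel
  have hu2 : IsUnit ((E + star E - 1) * (E + star E - 1)) := by
    rw [hB]
    refine isUnit_of_forall_le_norm_inner_map _ (c := 1) one_pos fun x => ?_
    have : inner ℝ ((1 + (E - star E) * star (E - star E)) x) x
        = ‖x‖ ^ 2 + ‖star (E - star E) x‖ ^ 2 := by
      rw [add_apply, inner_add_left, one_apply_eq_self, real_inner_self_eq_norm_sq, mul_apply_eq_comp,
        ← real_inner_self_eq_norm_sq (star (E - star E) x)]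
      rw [star_eq_adjoint (E - star E), adjoint_inner_right, real_inner_comm]
    rw [this, NNReal.coe_one, mul_one, Real.norm_of_nonneg (by positivity)]
    nlinarith [sq_nonneg ‖star (E - star E) x‖]
  have hu : IsUnit (E + star E - 1) := (isUnit_pow_iff two_ne_zero).1 (by rwa [pow_two])
  refine ⟨hu, ?_⟩
  have hPB : P * (E + star E - 1) = E := by
    have : P * star E = P := by rw [← hP, ← star_mul, hEP]
    rw [mul_sub, mul_add, hPE, this, mul_one, add_sub_cancel_right]
  calc P = P * ((E + star E - 1) * Ring.inverse (E + star E - 1)) := by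
        rw [Ring.mul_inverse_cancel _ hu, mul_one]
    _ = _ := by rw [← mul_assoc, hPB]

namespace HilbertGr

theorem star_proj (V : HilbertGr H) : star V.proj = V.proj :=
  isSelfAdjoint_starProjection V.space

theorem proj_mul_proj (V : HilbertGr H) : V.proj * V.proj = V.proj :=
  V.space.isIdempotentElem_starProjection

theorem proj_apply_mem (V : HilbertGr H) (x : H) : V.proj x ∈ V.space :=
  V.space.starProjection_apply_mem x

theorem proj_apply_eq_self {V : HilbertGr H} {x : H} (hx : x ∈ V.space) : V.proj x = x :=
  Submodule.starProjection_eq_self_iff.2 hx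

/-- F carries the range of one projection into that of the other; the adjoint relation gives the
same for F* in the opposite direction. -/
theorem space_map_eq {V W : HilbertGr H} {F : H →L[ℝ] H} (hF : F ∈ unitary (H →L[ℝ] H))
    (h : W.proj * F = F * V.proj) : V.space.map (F : H →ₗ[ℝ] H) = W.space := by
  have hF1 : F * star F = 1 := (Unitary.mem_iff.1 hF).2
  have hF2 : star F * F = 1 := (Unitary.mem_iff.1 hF).1
  ext y
  constructor
  · rintro ⟨x, hx, rfl⟩
    have : F x = W.proj (F x) := by
      have := congr($h x)
      rw [mul_apply_eq_comp, mul_apply_eq_comp, proj_apply_eq_self hx] at this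
      exact this.symm
    change F x ∈ W.space
    rw [this]
    exact proj_apply_mem _ _
  · intro hy
    have h' : star F * W.proj = V.proj * star F := by
      have := congrArg star h
      rw [star_mul, star_mul, star_proj, star_proj] at this
      exact this
    refine ⟨star F y, ?_, ?_⟩
    · have := congr($h' y)
      rw [mul_apply_eq_comp, mul_apply_eq_comp, proj_apply_eq_self hy] at this
      rw [this]
      exact proj_apply_mem _ _
    · exact congr($hF1 y)

/-- The orthogonal projection onto `Ψ⁻¹ Vstar` in terms of `Ψ`. -/
theorem proj_eq_of_map_eq {V Vstar : HilbertGr H} {T : H →L[ℝ] H} (hT : IsUnit T)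
    (h : V.space.map (T : H →ₗ[ℝ] H) = Vstar.space) {E : H →L[ℝ] H}
    (hE : E = Ring.inverse T * Vstar.proj * T) :
    IsUnit (E + star E - 1) ∧ V.proj = E * Ring.inverse (E + star E - 1) := by
  have h1 : Ring.inverse T * T = 1 := Ring.inverse_mul_cancel _ hT
  have hfix : ∀ x ∈ V.space, E x = x := by
    intro x hx
    have hTx : T x ∈ Vstar.space := h ▸ Submodule.mem_map_of_mem hx
    rw [hE, mul_apply_eq_comp, mul_apply_eq_comp, proj_apply_eq_self hTx]
    exact congr($h1 x)
  have hran : ∀ x, E x ∈ V.space := by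
    intro x
    have : Vstar.proj (T x) ∈ V.space.map (T : H →ₗ[ℝ] H) := h ▸ proj_apply_mem _ _
    obtain ⟨y, hy, hyx⟩ := this
    have : E x = y := by
      rw [hE, mul_apply_eq_comp, mul_apply_eq_comp, ← hyx]
      exact congr($h1 y)
    rwa [this]
  refine eq_mul_inverse_of_idempotent (star_proj V) ?_ ?_ ?_
  · ext x; exact hfix _ (hran x)
  · ext x; exact proj_apply_eq_self (hran x)
  · ext x; exact hfix _ (proj_apply_mem _ _)

/-- Locally Ψ_t⁻¹ P_* Ψ_t is a C^k idempotent with range V_t, to which Kato's formula applies. -/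
theorem IsCkCurve.contDiffOn_proj {k : WithTop ℕ∞} {I : Set ℝ} {V : ℝ → HilbertGr H}
    (hV : IsCkCurve k I V) : ContDiffOn ℝ k (fun t => (V t).proj) I := by
  intro t₀ ht₀
  obtain ⟨ε, hε, Ψ, Vstar, hΨ, hmap⟩ := hV t₀ ht₀
  have hmem : t₀ ∈ I ∩ Ioo (t₀ - ε) (t₀ + ε) := ⟨ht₀, by constructor <;> linarith⟩
  refine ContDiffWithinAt.mono_of_mem_nhdsWithin (s := I ∩ Ioo (t₀ - ε) (t₀ + ε)) ?_
    (inter_mem self_mem_nhdsWithin (mem_nhdsWithin_of_mem_nhds (isOpen_Ioo.mem_nhds hmem.2)))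
  have hE := (hΨ t₀ hmem).conj_of_isUnit Vstar.proj (hmap t₀ hmem).1
  exact (hE.mul_inverse_add_star (proj_eq_of_map_eq (hmap t₀ hmem).1 (hmap t₀ hmem).2 rfl).1).congr
    (fun t ht => (proj_eq_of_map_eq (hmap t ht).1 (hmap t ht).2 rfl).2)
    (proj_eq_of_map_eq (hmap t₀ hmem).1 (hmap t₀ hmem).2 rfl).2

end HilbertGr

end Curves

theorem corollaryA3 {H : Type*} [NormedAddCommGroup H] [InnerProductSpace ℝ H] [CompleteSpace H]
    [TopologicalSpace.SeparableSpace H] (hH : ¬ FiniteDimensional ℝ H)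
    (k : WithTop ℕ∞) (a b : ℝ) (hab : a ≤ b) :
    -- lifting of curves of closed subspaces
    (∀ V : ℝ → HilbertGr H, HilbertGr.IsCkCurve k (Icc a b) V →
      ∀ W ∈ connectedComponent (V a), ∀ φ ∈ orthogonalGroup H,
        W.space.map (φ : H →ₗ[ℝ] H) = (V a).space →
        ∃ Φ : ℝ → (H →L[ℝ] H), ContDiffOn ℝ k Φ (Icc a b) ∧
          (∀ t ∈ Icc a b, Φ t ∈ orthogonalGroup H ∧
            W.space.map (Φ t : H →ₗ[ℝ] H) = (V t).space) ∧
          Φ a = φ) ∧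
    -- the version for paths of symmetries
    (∀ J : ℝ → (H →L[ℝ] H), ContDiffOn ℝ k J (Icc a b) → (∀ t ∈ Icc a b, IsSymmetryOp (J t)) →
      ∃ (U : ℝ → (H →L[ℝ] H)) (J₀ : H →L[ℝ] H), ContDiffOn ℝ k U (Icc a b) ∧
        IsSymmetryOp J₀ ∧
        ∀ t ∈ Icc a b, U t ∈ orthogonalGroup H ∧
          U t * J t * ContinuousLinearMap.adjoint (U t) = J₀) := by
  constructor
  · intro V hV W _ φ hφ hW
    obtain ⟨F, hF, hFJ, hFa⟩ := exists_contDiffOn_unitary_intertwining hab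
      (J := fun t => (2 : ℝ) • (V t).proj - 1)
      ((hV.contDiffOn_proj.const_smul 2).sub contDiffOn_const) (fun t _ => by
        constructor
        · rw [star_sub, star_smul, star_one, HilbertGr.star_proj, star_trivial]
        · rw [sub_mul, mul_sub, smul_mul_smul_comm, HilbertGr.proj_mul_proj, one_mul, mul_one,
            sub_sub_eq_add_sub, mul_smul, two_smul ℝ ((2 : ℝ) • (V t).proj)]
          abel)
    refine ⟨fun t => F t * φ, hF.mul contDiffOn_const, fun t ht => ⟨?_, ?_⟩, ?_⟩
    · exact (unitary (H →L[ℝ] H)).mul_mem (hFJ t ht).1 hφ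
    · have hint : (V t).proj * F t = F t * (V a).proj := by
        have h := (hFJ t ht).2
        simp only [sub_mul, mul_sub, one_mul, mul_one, smul_mul_assoc, mul_smul_comm] at h
        exact smul_right_injective _ (two_ne_zero (α := ℝ)) (sub_left_injective h)
      rw [← HilbertGr.space_map_eq (hFJ t ht).1 hint, ← hW, ← Submodule.map_comp]
      rfl
    · change F a * φ = φ
      rw [hFa, one_mul]
  · intro J hJ hs
    obtain ⟨F, hF, hFJ, -⟩ := exists_contDiffOn_unitary_intertwining hab hJ
      (fun t ht => ⟨(hs t ht).1, (hs t ht).2⟩)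
    -- J_t F_t = F_t J_a means F_t* J_t F_t = J_a.
    refine ⟨fun t => star (F t), J a, ?_, hs a (left_mem_Icc.2 hab), fun t ht => ⟨?_, ?_⟩⟩
    · exact (starL' ℝ : (H →L[ℝ] H) ≃L[ℝ] (H →L[ℝ] H)).contDiff.comp_contDiffOn hF
    · exact Unitary.star_mem (hFJ t ht).1
    · rw [← star_eq_adjoint, star_star, mul_assoc, (hFJ t ht).2, ← mul_assoc,
        (Unitary.mem_iff.1 (hFJ t ht).1).1, one_mul]
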